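/- Let $H$ be a finite connected $\Delta$-regular graph with $\Delta\ge 2$, with $v_H$ vertices and $e(H)$ edges, and let $\delta>0$. For a graph $G$ let $N(H,G)$ be the number of labelled copies of $H$ in $G$ (injective maps $V(H)\to V(G)$ sending edges to edges), and for an edge $e$ of $G$ let $N(H,G,e)$ be the number of those copies that contain $e$. For $\varepsilon>0$, $\bar C>0$, $n\in\mathbb N$ and $p\in(0,1)$ call a graph $G\subset K_n$ a core graph if (C1) $N(H,G)\ge \delta(1-3\varepsilon)\,n^{v_H}p^{e(H)}$, (C2) $e(G)\le \bar C\, n^2p^{\Delta}\log(1/p)$, (C3) $N(H,G,e)\ge \delta\varepsilon\, n^{v_H}p^{e(H)}/\big(\bar C n^2p^{\Delta}\log(1/p)\big)$ for every edge $e$ of $G$. Then for every $\varepsilon>0$ there is a constant $C_0>0$, depending only on $H$, $\delta$ and $\varepsilon$, such that for every $\bar C\ge C_0$ the following holds. Let $p=p_n\in(0,1)$ satisfy $np^{\Delta/2}\to\infty$ and $np^{\Delta}\ll(\log n)^{-\Delta v_H}$ as $n\to\infty$, where $a_n\ll b_n$ means $a_n/b_n\to 0$. Then, for all sufficiently large $n$,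 $$\mathbb P\big(N(H,\mathbb G(n,p))\ge(1+\delta)n^{v_H}p^{e(H)}\big)\le(1+\varepsilon)\,\mathbb P\big(\mathbb G(n,p)\text{ contains a core graph}\big),$$ where $\mathbb G(n,p)$ is the Erdős–Rényi random graph on $n$ vertices with edge probability $p$, and "contains" means "has as a subgraph". -/

import Mathlib

open Filter Asymptotics Topology

namespace UpperTail

/-- `N(H, G, e)`: the number of labelled copies of `H` in `G` that contain the edge `e`, i.e. of
injective graph homomorphisms `φ : H → G` such that `e` is the image of an edge of `H`.
(The number `N(H, G)` of all labelled copies is `G.labelledCopyCount H`.) -/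
noncomputable def labelledCopyCountAt {W V : Type*} (H : SimpleGraph W) (G : SimpleGraph V)
    (e : Sym2 V) : ℕ :=
  Nat.card {φ : H.Copy G // ∃ f ∈ H.edgeSet, Sym2.map φ f = e}

/-- The upper tail event `UT(H, δ)` for graphs on `n` labelled vertices: the number of labelled
copies of `H` is at least `(1 + δ) n ^ v(H) p ^ e(H)`. -/
def upperTail {W : Type*} [Fintype W] (H : SimpleGraph W) (δ : ℝ) (n : ℕ) (p : ℝ) :
    Set (SimpleGraph (Fin n)) :=
  {G | (1 + δ) * (n : ℝ) ^ Fintype.card W * p ^ H.edgeSet.ncard ≤ (G.labelledCopyCount H : ℝ)}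

/-- Core graphs `G ⊆ K_n` (for the graph `H`, the degree `Δ`, and the constants `δ`, `ε`, `C`).
A subgraph of `K_n` is given by its set of edges; isolated vertices play no role below. -/
structure IsCore {W : Type*} [Fintype W] (H : SimpleGraph W) (Δ : ℕ) (δ ε C : ℝ) (n : ℕ) (p : ℝ)
    (G : SimpleGraph (Fin n)) : Prop where
  /-- `G` contains many labelled copies of `H`. -/
  many_copies :
    δ * (1 - 3 * ε) * (n : ℝ) ^ Fintype.card W * p ^ H.edgeSet.ncard ≤ (G.labelledCopyCount H : ℝ)
  /-- `G` does not have too many edges. -/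
  few_edges : (G.edgeSet.ncard : ℝ) ≤ C * (n : ℝ) ^ 2 * p ^ Δ * Real.log (1 / p)
  /-- Every edge of `G` lies in many labelled copies of `H`. -/
  edge_copies : ∀ e ∈ G.edgeSet,
    δ * ε * (n : ℝ) ^ Fintype.card W * p ^ H.edgeSet.ncard
      / (C * (n : ℝ) ^ 2 * p ^ Δ * Real.log (1 / p)) ≤ (labelledCopyCountAt H G e : ℝ)

/-- The event that a graph on `n` labelled vertices contains a core graph. -/
def containsCore {W : Type*} [Fintype W] (H : SimpleGraph W) (Δ : ℕ) (δ ε C : ℝ) (n : ℕ) (p : ℝ) :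
    Set (SimpleGraph (Fin n)) :=
  {Γ | ∃ G ≤ Γ, IsCore H Δ δ ε C n p G}

end UpperTail

/-! Write μ = n^{v(H)} p^{e(H)} and m = C n² p^Δ log(1/p). The upper tail without a core is
controlled by a high moment of the copy count, restricted to coreless graphs. Opening the k-th power
one factor at a time accumulates a graph U with at most k·e(H) ≤ m edges; each new factor costs ∑_φ
p^{missing}, which bounds the expected number of copies given U.

In a coreless graph such a U has at most δ(1-2ε)μ copies of H, since otherwise deleting edges that
lie in few copies would leave a core (`exists_isCore_le`). Maps that send a proper nonempty set of
edges of H into U are negligible, by Finner's inequality and the connectedness of H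
(`edgeMapCount_le_of_regular`). So a factor costs at most (1+δ-δε)μ, and Markov gives q^k with q =
(1+δ-δε)/(1+δ) < 1 and k = ⌊m/e(H)⌋ (`real_upperTail_le`).

Conversely, a clique on order n p^{Δ/2} vertices contains a core, so a core appears with probability
at least exp(-K² n² p^Δ log(1/p)), where K does not depend on C (`exp_neg_le_real_containsCore`).
For C large, q^k is at most ε times this probability. -/

namespace UpperTail
open MeasureTheory Finset
open scoped ENNReal

/-! ### Counting partial copies with Finner's inequality -/

/-- Finner's inequality. -/
theorem lmarginal_prod_rpow_le {W V ι : Type*} [DecidableEq W] [MeasurableSpace V]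
    (μ : Measure V) [SigmaFinite μ] (I : Finset ι) (S : ι → Finset W) (w : ι → ℝ)
    (hw : ∀ i ∈ I, 0 ≤ w i) (f : ι → (W → V) → ℝ≥0∞) (hf : ∀ i, Measurable (f i))
    (hdep : ∀ i ∈ I, ∀ v ∉ S i, ∀ x y, f i (Function.update x v y) = f i x)
    (T : Finset W) (hT : ∀ v ∈ T, ∑ i ∈ I with v ∈ S i, w i = 1) (x : W → V) :
    (∫⋯∫⁻_T, (fun φ => ∏ i ∈ I, f i φ ^ w i) ∂(fun _ => μ)) x ≤
      ∏ i ∈ I, (∫⋯∫⁻_(T ∩ S i), f i ∂(fun _ => μ)) x ^ w i := by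
  induction T using Finset.induction generalizing x with
  | empty => simp
  | insert v T hv ih =>
    have hmeas : Measurable fun φ => ∏ i ∈ I, f i φ ^ w i :=
      Finset.measurable_fun_prod _ fun i _ => (hf i).pow_const _
    rw [lmarginal_insert _ hmeas hv]
    refine (lintegral_mono fun y => ih (fun u hu => hT u (mem_insert_of_mem hu)) _).trans ?_
    have hout : ∀ i ∈ I, v ∉ S i → ∀ y, (∫⋯∫⁻_(T ∩ S i), f i ∂(fun _ => μ))
        (Function.update x v y) = (∫⋯∫⁻_(T ∩ S i), f i ∂(fun _ => μ)) x := by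
      intro i hi hvi y
      rw [lmarginal_update_of_notMem (hf i) (by simp [hvi])]
      congr 1
      funext z
      exact hdep i hi v hvi z y
    have hsplit : ∀ g : ι → ℝ≥0∞, ∏ i ∈ I, g i =
        (∏ i ∈ I with v ∈ S i, g i) * ∏ i ∈ I with v ∉ S i, g i :=
      fun g => (prod_filter_mul_prod_filter_not I _ g).symm
    calc _ = ∫⁻ y, (∏ i ∈ I with v ∈ S i, (∫⋯∫⁻_(T ∩ S i), f i ∂(fun _ => μ))
            (Function.update x v y) ^ w i) *
              ∏ i ∈ I with v ∉ S i, (∫⋯∫⁻_(T ∩ S i), f i ∂(fun _ => μ)) x ^ w i ∂μ := by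
          refine lintegral_congr fun y => ?_
          rw [hsplit]
          congr 1
          refine prod_congr rfl fun i hi => ?_
          rw [mem_filter] at hi
          rw [hout i hi.1 hi.2]
      _ ≤ _ := by
          have hm : ∀ i, Measurable fun y => (∫⋯∫⁻_(T ∩ S i), f i ∂(fun _ => μ))
              (Function.update x v y) :=
            fun i => ((hf i).lmarginal _).comp (measurable_update x)
          rw [lintegral_mul_const _
            (Finset.measurable_fun_prod _ fun i _ => (hm i).pow_const _), hsplit]
          refine mul_le_mul' ?_ (le_of_eq ?_)
          -- Hölder in the variable `v`: the weights of the factors that see `v` sum to one.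
          · refine (ENNReal.lintegral_prod_norm_pow_le _ (fun i _ => (hm i).aemeasurable)
              (hT v (mem_insert_self _ _))
              fun i hi => hw i (mem_filter.1 hi).1).trans (le_of_eq ?_)
            refine prod_congr rfl fun i hi => ?_
            rw [mem_filter] at hi
            rw [insert_inter_of_mem hi.2, lmarginal_insert _ (hf i) (by simp [hv])]
          · refine prod_congr rfl fun i hi => ?_
            rw [mem_filter] at hi
            rw [insert_inter_of_notMem hi.2]

/-- The number of maps sending all pairs in `F` to edges of `G`. -/
noncomputable def edgeMapCount {W V : Type*} [Fintype W] [DecidableEq W] [Fintype V]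
    (F : Finset (Sym2 W)) (G : SimpleGraph V) : ℕ := by
  classical exact #{φ : W → V | ∀ e ∈ F, Sym2.map φ e ∈ G.edgeSet}

theorem sum_adj_indicator {V : Type*} [Fintype V] (G : SimpleGraph V) [DecidableRel G.Adj] :
    ∑ a, ∑ b, (if G.Adj a b then (1 : ℝ≥0∞) else 0) = ((2 * G.edgeSet.ncard : ℕ) : ℝ≥0∞) := by
  classical
  rw [Set.ncard_eq_toFinset_card']
  change _ = ((2 * #G.edgeFinset : ℕ) : ℝ≥0∞)
  rw [← G.sum_degrees_eq_twice_card_edges]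
  push_cast
  refine sum_congr rfl fun a _ => ?_
  rw [sum_boole, ← G.card_neighborFinset_eq_degree]
  congr 2
  ext; simp

theorem sum_nonisolated_le {V : Type*} [Fintype V] (G : SimpleGraph V) :
    (by classical exact ∑ a, (if ∃ b, G.Adj a b then (1 : ℝ≥0∞) else 0)) ≤
      ((2 * G.edgeSet.ncard : ℕ) : ℝ≥0∞) := by
  classical
  rw [← sum_adj_indicator G]
  refine sum_le_sum fun a _ => ?_
  split_ifs with h
  · obtain ⟨b, hb⟩ := h
    refine le_trans (by simp [hb]) (single_le_sum (f := fun b => if G.Adj a b then (1 : ℝ≥0∞) else 0)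
      (fun _ _ => zero_le) (mem_univ b))
  · simp

/-- Finner's inequality for counting measure, with weight 1/Δ on each edge of `F`. The slack 1 -
d(v)/Δ at a vertex is filled by a one-vertex factor: the indicator of non-isolated vertices of `G`,
of which there are at most 2e(G), or the constant 1 if `F` does not cover `v`. -/
theorem edgeMapCount_le {W V : Type*} [Fintype W] [DecidableEq W] [Fintype V]
    (F : Finset (Sym2 W)) (hF : ∀ e ∈ F, ¬ e.IsDiag) (Δ : ℕ) (hΔ : 0 < Δ)
    (hdeg : ∀ v, #{e ∈ F | v ∈ e} ≤ Δ) (G : SimpleGraph V) :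
    (edgeMapCount F G : ℝ) ≤ (2 * G.edgeSet.ncard : ℝ) ^ ((#F : ℝ) / Δ) *
      ∏ v : W, if #{e ∈ F | v ∈ e} = 0 then (Fintype.card V : ℝ) else
        (2 * G.edgeSet.ncard : ℝ) ^ (1 - (#{e ∈ F | v ∈ e} : ℝ) / Δ) := by
  classical
  have hΔ' : (0 : ℝ) < Δ := by exact_mod_cast hΔ
  let _ : MeasurableSpace V := ⊤
  -- Marginal integrals need a base point `x`, even when every variable is integrated out.
  rcases isEmpty_or_nonempty (W → V) with hem | ⟨⟨x⟩⟩
  · have : edgeMapCount F G = 0 := by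
      rw [edgeMapCount]; simp
    rw [this]
    push_cast
    refine mul_nonneg (by positivity) (prod_nonneg fun v _ => ?_)
    split_ifs <;> positivity
  set d : W → ℕ := fun v => #{e ∈ F | v ∈ e} with hd
  set I : Finset (Sym2 W ⊕ W) := F.disjSum univ
  set S : Sym2 W ⊕ W → Finset W := Sum.elim (fun e => e.toFinset) (fun v => {v})
  set w : Sym2 W ⊕ W → ℝ := Sum.elim (fun _ => 1 / Δ) (fun v => 1 - (d v : ℝ) / Δ)
  set f : Sym2 W ⊕ W → (W → V) → ℝ≥0∞ := Sum.elim
    (fun e φ => if Sym2.map φ e ∈ G.edgeSet then 1 else 0)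
    (fun v φ => if d v = 0 then 1 else if ∃ b, G.Adj (φ v) b then 1 else 0)
  have hfm : ∀ i, Measurable (f i) := fun i => measurable_of_finite _
  have hwn : ∀ i ∈ I, 0 ≤ w i := by
    rintro (e | v) -
    · simp [w]
    · simp only [w, Sum.elim_inr, sub_nonneg]
      rw [div_le_one hΔ']
      exact_mod_cast hdeg v
  have key := lmarginal_prod_rpow_le (Measure.count : Measure V) I S w hwn f hfm
    (by
      rintro (e | v) - u hu φ y
      · have : Sym2.map (Function.update φ u y) e = Sym2.map φ e := by
          refine Sym2.map_congr fun z hz => ?_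
          rw [Function.update_of_ne]
          rintro rfl
          exact hu (by simpa [S] using hz)
        simp [f, this]
      · have : u ≠ v := by simpa [S] using hu
        simp [f, Function.update_of_ne this.symm])
    univ
    (by
      intro v _
      rw [sum_filter, sum_disjSum]
      simp only [S, w, Sum.elim_inl, Sum.elim_inr, Sym2.mem_toFinset, mem_singleton]
      rw [← sum_filter, sum_const, sum_ite_eq]
      simp only [mem_univ, if_true, nsmul_eq_mul, d]
      ring) x
  have hlow : (edgeMapCount F G : ℝ≥0∞) ≤
      (∫⋯∫⁻_univ, (fun φ => ∏ i ∈ I, f i φ ^ w i) ∂(fun _ => (Measure.count : Measure V))) x := by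
    have hpi : ∀ φ : W → V, Measure.pi (fun _ : W => (Measure.count : Measure V)) {φ} = 1 := by
      intro φ
      rw [Measure.pi_singleton]
      simp
    rw [lmarginal_univ, lintegral_fintype, edgeMapCount, card_filter]
    push_cast
    simp only [hpi, mul_one]
    refine sum_le_sum fun φ _ => ?_
    split_ifs with h
    · rw [prod_eq_one]
      rintro (e | v) hi
      · have he : e ∈ F := by simpa [I] using hi
        simp [f, h e he]
      · by_cases hv : d v = 0
        · simp [f, hv]
        · have : ∃ b, G.Adj (φ v) b := by
            obtain ⟨e, he⟩ := card_pos.1 (Nat.pos_of_ne_zero hv)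
            rw [mem_filter] at he
            obtain ⟨u, rfl⟩ := he.2
            exact ⟨φ u, by simpa using h _ he.1⟩
          simp [f, this]
    · exact zero_le
  have hup : ∏ i ∈ I, (∫⋯∫⁻_(univ ∩ S i), f i ∂(fun _ => (Measure.count : Measure V))) x ^ w i ≤
      ENNReal.ofReal ((2 * G.edgeSet.ncard : ℝ) ^ ((#F : ℝ) / Δ) *
      ∏ v : W, if d v = 0 then (Fintype.card V : ℝ) else
        (2 * G.edgeSet.ncard : ℝ) ^ (1 - (d v : ℝ) / Δ)) := by
    rw [prod_disjSum, ENNReal.ofReal_mul (p := (2 * G.edgeSet.ncard : ℝ) ^ ((#F : ℝ) / Δ))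
      (by positivity), ENNReal.ofReal_prod_of_nonneg
      (fun v _ => by split_ifs <;> positivity)]
    have hM : ENNReal.ofReal (2 * G.edgeSet.ncard : ℝ) = ((2 * G.edgeSet.ncard : ℕ) : ℝ≥0∞) := by
      rw [← ENNReal.ofReal_natCast]; norm_num
    refine mul_le_mul' ?_ (prod_le_prod' fun v _ => ?_)
    · have hpow : ENNReal.ofReal ((2 * G.edgeSet.ncard : ℝ) ^ ((#F : ℝ) / Δ)) =
          ∏ e ∈ F, ENNReal.ofReal (2 * G.edgeSet.ncard : ℝ) ^ (1 / (Δ : ℝ)) := by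
        rw [prod_const, ← ENNReal.ofReal_rpow_of_nonneg (x := (2 * G.edgeSet.ncard : ℝ)) (by positivity)
            (div_nonneg (Nat.cast_nonneg _) hΔ'.le),
          ← ENNReal.rpow_natCast, ← ENNReal.rpow_mul]
        congr 1; ring
      rw [hpow]
      refine prod_le_prod' fun e he => ?_
      refine ENNReal.rpow_le_rpow ?_ (hwn (Sum.inl e) (by simp [I, he]))
      rw [hM, ← sum_adj_indicator G, univ_inter]
      induction e using Sym2.ind with
      | _ a b =>
        have hab : a ≠ b := by simpa using hF _ he
        have hS : S (Sum.inl s(a, b)) = insert a {b} := by ext; simp [S]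
        rw [hS, lmarginal_insert _ (hfm _) (by simpa using hab), lintegral_count, tsum_fintype]
        refine sum_le_sum fun y _ => ?_
        rw [lmarginal_singleton]
        dsimp only
        rw [lintegral_count, tsum_fintype]
        refine sum_le_sum fun z _ => ?_
        simp [f, Function.update_of_ne hab]
    · simp only [S, f, w, Sum.elim_inr, univ_inter]
      rw [lmarginal_singleton]
      dsimp only
      rw [lintegral_count, tsum_fintype]
      by_cases hv : d v = 0
      · simp [hv]
      · simp only [hv, if_false, Function.update_self]
        rw [← ENNReal.ofReal_rpow_of_nonneg (by positivity)]
        · refine ENNReal.rpow_le_rpow ?_ ?_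
          · rw [hM]
            exact sum_nonisolated_le G
          · exact hwn (Sum.inr v) (by simp [I])
        · exact hwn (Sum.inr v) (by simp [I])
  have hfin := hlow.trans (key.trans hup)
  rw [← ENNReal.ofReal_natCast, ENNReal.ofReal_le_ofReal_iff] at hfin
  · exact hfin
  · refine mul_nonneg (by positivity) (prod_nonneg fun v _ => ?_)
    split_ifs <;> positivity

end UpperTail

/-! ### Moments of the copy count in the random graph -/

namespace UpperTail
open MeasureTheory Finset ProbabilityTheory
open scoped ENNReal

theorem measurableSingletonClass_simpleGraph (V : Type*) [Finite V] :
    MeasurableSingletonClass (SimpleGraph V) where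
  measurableSet_singleton G := by
    have : ({G} : Set (SimpleGraph V)) = SimpleGraph.edgeSet ⁻¹' {G.edgeSet} := by
      ext; simp
    rw [this]
    exact SimpleGraph.measurable_edgeSet (Set.toFinite _).measurableSet

theorem binomialRandom_real_ge {V : Type*} [Fintype V] (p : unitInterval) (G : SimpleGraph V) :
    (SimpleGraph.binomialRandom V p).real {Γ | G ≤ Γ} = (p : ℝ) ^ G.edgeSet.ncard := by
  classical
  -- The random edge set almost surely avoids the diagonal, so that restriction can be dropped and
  -- the event becomes a cylinder.
  have himg : (SimpleGraph.edgeSet '' {Γ | G ≤ Γ} : Set (Set (Sym2 V))) =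
      {s ∈ {s : Set (Sym2 V) | G.edgeSet ⊆ s} | s ⊆ Sym2.diagSetᶜ} := by
    ext s
    simp only [Set.mem_image, Set.mem_ofPred_eq]
    constructor
    · rintro ⟨Γ, h, rfl⟩
      exact ⟨SimpleGraph.edgeSet_subset_edgeSet.2 h, Γ.edgeSet_subset_compl_diagSet⟩
    · rintro ⟨h, hd⟩
      refine ⟨SimpleGraph.fromEdgeSet s, ?_, ?_⟩
      · rw [← SimpleGraph.edgeSet_subset_edgeSet, SimpleGraph.edgeSet_fromEdgeSet]
        exact fun e he => ⟨h he, G.edgeSet_subset_compl_diagSet he⟩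
      · rw [SimpleGraph.edgeSet_fromEdgeSet]
        ext e
        exact ⟨fun h => h.1, fun h => ⟨h, hd h⟩⟩
  rw [measureReal_def, SimpleGraph.binomialRandom_apply', himg,
    ← setBernoulli_apply_eq_apply_subsets, setBernoulli_apply']
  have hpre : ((fun q : Sym2 V → Prop => {i | q i}) ⁻¹' {s : Set (Sym2 V) | G.edgeSet ⊆ s}) =
      Set.pi (G.edgeFinset : Set (Sym2 V)) (fun _ => {True}) := by
    ext q
    simp [Set.subset_def, Set.mem_pi]
  rw [hpre, Measure.infinitePi_pi _ (fun _ _ => MeasurableSet.of_discrete), ENNReal.toReal_prod,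
    Set.ncard_eq_toFinset_card', ← prod_const]
  refine prod_congr rfl fun e he => ?_
  have : e ∈ (Sym2.diagSetᶜ : Set (Sym2 V)) :=
    G.edgeSet_subset_compl_diagSet (by simpa using he)
  have h' : (e ∈ (Sym2.diagSetᶜ : Set (Sym2 V))) = True := by simp only [this]
  simp only [h']
  simp

theorem labelledCopyCount_eq_card {W V : Type*} [Fintype W] [Fintype V] (H : SimpleGraph W)
    (G : SimpleGraph V) : G.labelledCopyCount H =
      (by classical exact #{φ : W ↪ V | H.map φ ≤ G}) := by
  classical
  rw [SimpleGraph.labelledCopyCount, ← Fintype.card_subtype]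
  refine Fintype.card_congr ⟨fun c => ⟨c.toEmbedding, ?_⟩, fun φ => ⟨⟨φ.1, ?_⟩, φ.1.injective⟩,
    fun c => rfl, fun φ => rfl⟩
  · rw [SimpleGraph.map_le_iff_le_comap]
    intro a b hab
    exact c.toHom.map_adj hab
  · intro a b hab
    exact (SimpleGraph.map_le_iff_le_comap _ _ _).1 φ.2 hab

/-- The number of edges of `H` that `φ` does not send to edges of `G`. -/
noncomputable def missing {W V : Type*} (H : SimpleGraph W) (φ : W ↪ V) (G : SimpleGraph V) : ℕ :=
  {e ∈ H.edgeSet | Sym2.map φ e ∉ G.edgeSet}.ncard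

theorem ncard_edgeSet_sup_map {W V : Type*} [Finite W] [Finite V] (H : SimpleGraph W) (φ : W ↪ V)
    (G : SimpleGraph V) :
    (G ⊔ H.map φ).edgeSet.ncard = G.edgeSet.ncard + missing H φ G := by
  have hm : missing H φ G = ((H.map φ).edgeSet \ G.edgeSet).ncard := by
    rw [missing, ← Set.ncard_image_of_injective _ (Sym2.map.injective φ.injective)]
    congr 1
    ext e
    simp only [Set.mem_image, Set.mem_sdiff, SimpleGraph.edgeSet_map, Set.mem_ofPred_eq]
    constructor
    · rintro ⟨f, ⟨h1, h2⟩, rfl⟩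
      exact ⟨⟨f, h1, rfl⟩, h2⟩
    · rintro ⟨⟨f, h1, rfl⟩, h2⟩
      exact ⟨f, ⟨h1, h2⟩, rfl⟩
  rw [SimpleGraph.edgeSet_sup, hm, ← Set.ncard_union_eq Set.disjoint_sdiff_right
    (Set.toFinite _) (Set.toFinite _), Set.union_sdiff_self]

theorem missing_le {W V : Type*} [Finite W] (H : SimpleGraph W) (φ : W ↪ V) (G : SimpleGraph V) :
    missing H φ G ≤ H.edgeSet.ncard :=
  Set.ncard_le_ncard (Set.sep_subset _ _) (Set.toFinite _)

/-- Moment bound for the number of copies on an event `A` whose members contain no bad graph. -/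
theorem sum_mul_labelledCopyCount_pow_le {W V : Type*} [Fintype W] [Fintype V]
    (H : SimpleGraph W) (p : unitInterval) (A : Finset (SimpleGraph V)) (m R : ℝ) (hR : 0 ≤ R)
    (good : SimpleGraph V → Prop)
    (hA : ∀ Γ ∈ A, ∀ U ≤ Γ, (U.edgeSet.ncard : ℝ) ≤ m → good U)
    (hgood : ∀ U, good U → (U.edgeSet.ncard : ℝ) ≤ m →
      ∑ φ : W ↪ V, (p : ℝ) ^ missing H φ U ≤ R) (k : ℕ) (U : SimpleGraph V)
    (hU : (U.edgeSet.ncard : ℝ) + k * H.edgeSet.ncard ≤ m) :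
    (by classical exact ∑ Γ ∈ A with U ≤ Γ, (SimpleGraph.binomialRandom V p).real {Γ} *
      (Γ.labelledCopyCount H : ℝ) ^ k) ≤ (p : ℝ) ^ U.edgeSet.ncard * R ^ k := by
  classical
  have hp0 : (0 : ℝ) ≤ p := p.2.1
  have := measurableSingletonClass_simpleGraph V
  -- One factor of the power is a sum over `φ`; the image of `φ` is absorbed into `U`, which gains
  -- at most e(H) edges and stays within the budget `m`.
  induction k generalizing U with
  | zero =>
    simp only [pow_zero, mul_one]
    rw [sum_measureReal_singleton, ← binomialRandom_real_ge]
    exact measureReal_mono (fun Γ hΓ => (by simpa using hΓ : Γ ∈ A ∧ U ≤ Γ).2)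
  | succ k ih =>
    -- Only a `U` lying inside some member of `A` is known to be good; for any other `U` the sum is
    -- empty.
    by_cases hne : ∃ Γ ∈ A, U ≤ Γ
    swap
    · rw [sum_eq_zero]
      · positivity
      · intro Γ hΓ
        rw [mem_filter] at hΓ
        exact (hne ⟨Γ, hΓ⟩).elim
    obtain ⟨Γ₀, hΓ₀, hle⟩ := hne
    have hUm : (U.edgeSet.ncard : ℝ) ≤ m := le_trans (by simp; positivity) hU
    have hUR := hgood U (hA Γ₀ hΓ₀ U hle hUm) hUm
    calc _ = ∑ Γ ∈ A with U ≤ Γ, ∑ φ : W ↪ V, if H.map φ ≤ Γ then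
            (SimpleGraph.binomialRandom V p).real {Γ} * (Γ.labelledCopyCount H : ℝ) ^ k else 0 := by
          refine sum_congr rfl fun Γ _ => ?_
          rw [← sum_filter, sum_const, nsmul_eq_mul, ← labelledCopyCount_eq_card]
          ring
      _ = ∑ φ : W ↪ V, ∑ Γ ∈ A with U ⊔ H.map φ ≤ Γ,
            (SimpleGraph.binomialRandom V p).real {Γ} * (Γ.labelledCopyCount H : ℝ) ^ k := by
          rw [sum_comm]
          refine sum_congr rfl fun φ _ => ?_
          rw [← sum_filter, filter_filter]
          simp only [sup_le_iff]
      _ ≤ ∑ φ : W ↪ V, (p : ℝ) ^ (U ⊔ H.map φ).edgeSet.ncard * R ^ k := by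
          refine sum_le_sum fun φ _ => ih _ (le_trans ?_ hU)
          rw [ncard_edgeSet_sup_map]
          have : (missing H φ U : ℝ) ≤ H.edgeSet.ncard := by exact_mod_cast missing_le H φ U
          push_cast
          linarith
      _ = (p : ℝ) ^ U.edgeSet.ncard * (∑ φ : W ↪ V, (p : ℝ) ^ missing H φ U) * R ^ k := by
          rw [mul_sum, sum_mul]
          refine sum_congr rfl fun φ _ => ?_
          rw [ncard_edgeSet_sup_map, pow_add]
      _ ≤ (p : ℝ) ^ U.edgeSet.ncard * R * R ^ k := by gcongr
      _ = _ := by ring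

/-- Markov's inequality for the k-th moment, starting the moment bound from the empty graph. -/
theorem real_upperTail_inter_le {W V : Type*} [Fintype W] [Fintype V]
    (H : SimpleGraph W) (p : unitInterval) (A : Set (SimpleGraph V)) (m R τ : ℝ) (hR : 0 ≤ R)
    (hτ : 0 < τ) (good : SimpleGraph V → Prop)
    (hA : ∀ Γ ∈ A, ∀ U ≤ Γ, (U.edgeSet.ncard : ℝ) ≤ m → good U)
    (hgood : ∀ U, good U → (U.edgeSet.ncard : ℝ) ≤ m →
      ∑ φ : W ↪ V, (p : ℝ) ^ missing H φ U ≤ R) (k : ℕ) (hk : (k * H.edgeSet.ncard : ℝ) ≤ m) :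
    (SimpleGraph.binomialRandom V p).real ({G | τ ≤ (G.labelledCopyCount H : ℝ)} ∩ A) ≤
      (R / τ) ^ k := by
  classical
  have := measurableSingletonClass_simpleGraph V
  set B : Finset (SimpleGraph V) := {G | τ ≤ (G.labelledCopyCount H : ℝ) ∧ G ∈ A} with hB
  have hBA : ({G | τ ≤ (G.labelledCopyCount H : ℝ)} ∩ A) = (B : Set (SimpleGraph V)) := by
    ext; simp [hB]
  have h := sum_mul_labelledCopyCount_pow_le H p B m R hR good
    (fun Γ hΓ => hA Γ (mem_filter.1 hΓ).2.2) hgood k ⊥ (by simpa using hk)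
  simp only [bot_le, filter_true, SimpleGraph.edgeSet_bot, Set.ncard_empty, pow_zero,
    one_mul] at h
  rw [hBA, ← sum_measureReal_singleton, div_pow, le_div_iff₀ (by positivity), sum_mul]
  refine (sum_le_sum fun Γ hΓ => ?_).trans h
  have := (mem_filter.1 hΓ).2.1
  gcongr

end UpperTail

/-! ### Extracting a core, and splitting the maps by their overlap with a graph -/

namespace UpperTail
open Finset

theorem labelledCopyCount_le_deleteEdges_add {W V : Type*} [Fintype W] [Fintype V]
    (H : SimpleGraph W) (G : SimpleGraph V) (e : Sym2 V) :
    G.labelledCopyCount H ≤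
      (G.deleteEdges {e}).labelledCopyCount H + labelledCopyCountAt H G e := by
  classical
  have hcard := Fintype.card_subtype_compl (fun φ : H.Copy G => ∃ f ∈ H.edgeSet, Sym2.map φ f = e)
  have hle := Fintype.card_subtype_le (fun φ : H.Copy G => ∃ f ∈ H.edgeSet, Sym2.map φ f = e)
  have hinj : Fintype.card {φ : H.Copy G // ¬ ∃ f ∈ H.edgeSet, Sym2.map φ f = e} ≤
      Fintype.card (H.Copy (G.deleteEdges {e})) := by
    refine Fintype.card_le_of_injective (fun φ => ⟨⟨φ.1, fun {a b} hab => ?_⟩, φ.1.injective⟩) ?_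
    · rw [SimpleGraph.deleteEdges_adj]
      exact ⟨φ.1.toHom.map_adj hab, fun h => φ.2 ⟨s(a, b), hab, h⟩⟩
    · intro φ ψ h
      ext a
      exact congrArg (fun c : H.Copy (G.deleteEdges {e}) => c a) h
  simp only [SimpleGraph.labelledCopyCount, labelledCopyCountAt]
  simp only [← Nat.card_eq_fintype_card] at hcard hle hinj ⊢
  omega

/-- Delete, one at a time, edges lying in fewer than `t` copies: each deletion loses fewer than `t`
copies, and the process stops. -/
theorem exists_le_forall_le_labelledCopyCountAt {W V : Type*} [Fintype W] [Fintype V]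
    (H : SimpleGraph W) (t : ℝ) (ht : 0 ≤ t) (G : SimpleGraph V) :
    ∃ G' ≤ G, (G.labelledCopyCount H : ℝ) - t * G.edgeSet.ncard ≤ G'.labelledCopyCount H ∧
      ∀ e ∈ G'.edgeSet, t ≤ labelledCopyCountAt H G' e := by
  induction hk : G.edgeSet.ncard using Nat.strong_induction_on generalizing G with
  | _ k ih =>
    by_cases hall : ∀ e ∈ G.edgeSet, t ≤ labelledCopyCountAt H G e
    · exact ⟨G, le_rfl, by simp; positivity, hall⟩
    · push Not at hall
      obtain ⟨e, he, hlt⟩ := hall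
      have hc : (G.deleteEdges {e}).edgeSet.ncard + 1 = G.edgeSet.ncard := by
        rw [SimpleGraph.edgeSet_deleteEdges]
        exact Set.ncard_sdiff_singleton_add_one he (Set.toFinite _)
      obtain ⟨G', hle, hN, hG'⟩ := ih _ (by omega) (G.deleteEdges {e}) rfl
      refine ⟨G', hle.trans (G.deleteEdges_le _), le_trans ?_ hN, hG'⟩
      have h1 : (G.labelledCopyCount H : ℝ) ≤
          (G.deleteEdges {e}).labelledCopyCount H + labelledCopyCountAt H G e := by
        exact_mod_cast labelledCopyCount_le_deleteEdges_add H G e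
      have h2 : (k : ℝ) = (G.deleteEdges {e}).edgeSet.ncard + 1 := by
        rw [← hk, ← hc]; push_cast; rfl
      rw [h2]
      linarith

theorem exists_isCore_le {W : Type*} [Fintype W] (H : SimpleGraph W) (Δ : ℕ) (δ ε C : ℝ)
    (hδ : 0 ≤ δ) (hε : 0 ≤ ε) (n : ℕ) (p : ℝ) (hp : 0 ≤ p) (G : SimpleGraph (Fin n))
    (hm : 0 < C * (n : ℝ) ^ 2 * p ^ Δ * Real.log (1 / p))
    (hG : (G.edgeSet.ncard : ℝ) ≤ C * (n : ℝ) ^ 2 * p ^ Δ * Real.log (1 / p))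
    (hN : δ * (1 - 2 * ε) * (n : ℝ) ^ Fintype.card W * p ^ H.edgeSet.ncard ≤
      (G.labelledCopyCount H : ℝ)) :
    ∃ G' ≤ G, IsCore H Δ δ ε C n p G' := by
  set m := C * (n : ℝ) ^ 2 * p ^ Δ * Real.log (1 / p)
  -- At most `m` deletions at cost `t` lose at most δεμ copies, which is the drop from 1-2ε to 1-3ε.
  set t := δ * ε * (n : ℝ) ^ Fintype.card W * p ^ H.edgeSet.ncard / m with ht
  have ht0 : 0 ≤ t := by positivity
  obtain ⟨G', hle, h1, h2⟩ := exists_le_forall_le_labelledCopyCountAt H t ht0 G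
  refine ⟨G', hle, ⟨?_, ?_, h2⟩⟩
  · have : t * G.edgeSet.ncard ≤ δ * ε * (n : ℝ) ^ Fintype.card W * p ^ H.edgeSet.ncard :=
      calc t * G.edgeSet.ncard ≤ t * m := by gcongr
        _ = _ := div_mul_cancel₀ _ hm.ne'
    linarith
  · refine le_trans ?_ hG
    exact_mod_cast Set.ncard_le_ncard (SimpleGraph.edgeSet_subset_edgeSet.2 hle) (Set.toFinite _)

/-- Sort `φ` by the set of edges it sends into `G`: none, all, or a proper nonempty `F`. In the last
case injectivity is dropped, so that Finner's inequality applies. -/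
theorem sum_pow_missing_le {W V : Type*} [Fintype W] [DecidableEq W] [Fintype V]
    (H : SimpleGraph W) (p : ℝ) (hp0 : 0 ≤ p) (hp1 : p ≤ 1)
    (E : Finset (Sym2 W)) (hE : (E : Set (Sym2 W)) = H.edgeSet) (G : SimpleGraph V) :
    ∑ φ : W ↪ V, p ^ missing H φ G ≤
      (Fintype.card V : ℝ) ^ Fintype.card W * p ^ #E + G.labelledCopyCount H +
        ∑ F ∈ E.powerset with F ≠ ∅ ∧ F ≠ E, edgeMapCount F G * p ^ (#E - #F) := by
  classical
  have hmem : ∀ e, e ∈ E ↔ e ∈ H.edgeSet := fun e => by rw [← hE]; simp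
  have hpt : ∀ φ : W ↪ V, p ^ missing H φ G ≤ p ^ #E + (if H.map φ ≤ G then (1 : ℝ) else 0) +
      ∑ F ∈ E.powerset with F ≠ ∅ ∧ F ≠ E,
        if (∀ e ∈ F, Sym2.map φ e ∈ G.edgeSet) then p ^ (#E - #F) else 0 := by
    intro φ
    set F₀ := {e ∈ E | Sym2.map φ e ∈ G.edgeSet} with hF₀
    have hsub : F₀ ⊆ E := filter_subset _ _
    have hmiss : missing H φ G = #E - #F₀ := by
      rw [← card_sdiff_of_subset hsub, missing, ← Set.ncard_coe_finset]
      congr 1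
      ext e
      simp only [Set.mem_ofPred_eq, ← hmem, coe_sdiff, Set.mem_sdiff, mem_coe, hF₀, mem_filter]
      tauto
    have hs0 : 0 ≤ ∑ F ∈ E.powerset with F ≠ ∅ ∧ F ≠ E,
        if (∀ e ∈ F, Sym2.map φ e ∈ G.edgeSet) then p ^ (#E - #F) else 0 :=
      sum_nonneg fun F _ => by split_ifs <;> positivity
    have hi0 : (0 : ℝ) ≤ if H.map φ ≤ G then (1 : ℝ) else 0 := by split_ifs <;> positivity
    have hp : 0 ≤ p ^ #E := by positivity
    by_cases h0 : F₀ = ∅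
    · rw [hmiss, h0, card_empty, Nat.sub_zero]
      linarith
    by_cases h1 : F₀ = E
    · have : H.map φ ≤ G := by
        rw [SimpleGraph.map_le_iff_le_comap]
        intro a b hab
        have : s(a, b) ∈ F₀ := by rw [h1, hmem]; exact hab
        simpa using (mem_filter.1 this).2
      rw [if_pos this] at hi0 ⊢
      have : p ^ missing H φ G ≤ 1 := pow_le_one₀ hp0 hp1
      linarith
    · have hFm : F₀ ∈ E.powerset.filter (fun F => F ≠ ∅ ∧ F ≠ E) := by
        simp only [mem_filter, mem_powerset]
        exact ⟨hsub, h0, h1⟩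
      have := single_le_sum (f := fun F : Finset (Sym2 W) =>
        if (∀ e ∈ F, Sym2.map φ e ∈ G.edgeSet) then p ^ (#E - #F) else 0)
        (fun F _ => by split_ifs <;> positivity) hFm
      rw [if_pos (fun e he => (mem_filter.1 he).2)] at this
      rw [hmiss]
      linarith
  refine (sum_le_sum fun φ _ => hpt φ).trans ?_
  rw [sum_add_distrib, sum_add_distrib]
  refine add_le_add (add_le_add ?_ ?_) ?_
  · rw [sum_const, nsmul_eq_mul]
    refine mul_le_mul_of_nonneg_right ?_ (by positivity)
    rw [card_univ, Fintype.card_embedding_eq]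
    exact_mod_cast Nat.descFactorial_le_pow _ _
  · rw [sum_boole, ← labelledCopyCount_eq_card]
  · rw [sum_comm]
    refine sum_le_sum fun F _ => ?_
    rw [← sum_filter, sum_const, nsmul_eq_mul]
    refine mul_le_mul_of_nonneg_right ?_ (by positivity)
    rw [edgeMapCount]
    norm_cast
    refine card_le_card_of_injOn (fun φ => φ) (fun φ hφ => ?_)
      (fun φ _ ψ _ h => DFunLike.coe_injective h)
    simpa using hφ

end UpperTail

/-! ### Cliques, and the overlap bound for connected regular graphs -/

namespace UpperTail
open Finset

theorem exists_clique {W : Type*} [Fintype W] (H : SimpleGraph W) {k n : ℕ} (hk : k ≤ n) :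
    ∃ G : SimpleGraph (Fin n), G.edgeSet.ncard ≤ k ^ 2 ∧
      (k + 1 - Fintype.card W) ^ Fintype.card W ≤ G.labelledCopyCount H := by
  classical
  refine ⟨(⊤ : SimpleGraph (Fin k)).map (Fin.castLEEmb hk), ?_, ?_⟩
  · rw [SimpleGraph.edgeSet_map]
    refine (Set.ncard_image_le (Set.toFinite _)).trans ?_
    rw [Set.ncard_eq_toFinset_card']
    refine (SimpleGraph.card_edgeFinset_le_card_choose_two (G := (⊤ : SimpleGraph (Fin k)))).trans ?_
    rw [Fintype.card_fin]
    exact Nat.choose_le_pow _ _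
  · refine (Nat.pow_sub_le_descFactorial _ _).trans ?_
    have : k.descFactorial (Fintype.card W) = Fintype.card (W ↪ Fin k) := by
      rw [Fintype.card_embedding_eq, Fintype.card_fin]
    rw [this, labelledCopyCount_eq_card, ← card_univ]
    refine card_le_card_of_injOn (fun φ => φ.trans (Fin.castLEEmb hk)) (fun φ _ => ?_) ?_
    · simp only [coe_filter, mem_univ, true_and, Set.mem_ofPred_eq]
      rw [show (φ.trans (Fin.castLEEmb hk) : W → Fin n) = Fin.castLEEmb hk ∘ φ from rfl,
        ← SimpleGraph.map_map]
      exact SimpleGraph.map_monotone _ le_top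
    · intro φ _ ψ _ h
      ext a
      have := DFunLike.congr_fun h a
      simp only [Function.Embedding.trans_apply, EmbeddingLike.apply_eq_iff_eq] at this
      rw [this]

theorem card_filter_mem_eq_degree {W : Type*} [Fintype W] [DecidableEq W] (H : SimpleGraph W)
    [DecidableRel H.Adj] (v : W) : #{e ∈ H.edgeFinset | v ∈ e} = H.degree v := by
  rw [← H.card_incidenceFinset_eq_degree, H.incidenceFinset_eq_filter]

theorem sum_card_filter_mem {W : Type*} [Fintype W] [DecidableEq W] (F : Finset (Sym2 W))
    (hF : ∀ e ∈ F, ¬ e.IsDiag) : ∑ v : W, #{e ∈ F | v ∈ e} = 2 * #F := by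
  have h := sum_card_bipartiteAbove_eq_sum_card_bipartiteBelow (s := (univ : Finset W)) (t := F)
    (fun v e => v ∈ e)
  simp only [bipartiteAbove, bipartiteBelow] at h
  rw [h, mul_comm, ← smul_eq_mul, ← sum_const]
  refine sum_congr rfl fun e he => ?_
  rw [← Sym2.card_toFinset_of_not_isDiag e (hF e he)]
  congr 1
  ext; simp

/-- Otherwise `F` contains all edges of `H` at every vertex it touches, so the touched vertices are
closed under adjacency; connectedness then forces `F` to be everything. -/
theorem exists_degree_pos_lt {W : Type*} [Fintype W] [DecidableEq W] (H : SimpleGraph W)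
    [DecidableRel H.Adj] (Δ : ℕ) (hreg : H.IsRegularOfDegree Δ) (hconn : H.Connected)
    (F : Finset (Sym2 W)) (hF : F ⊆ H.edgeFinset) (hne : F ≠ ∅) (hne' : F ≠ H.edgeFinset) :
    ∃ v, #{e ∈ F | v ∈ e} ≠ 0 ∧ #{e ∈ F | v ∈ e} < Δ := by
  by_contra hcon
  push Not at hcon
  have hfull : ∀ v, #{e ∈ F | v ∈ e} ≠ 0 → ∀ e ∈ H.edgeFinset, v ∈ e → e ∈ F := by
    intro v hv e he hve
    have : {e ∈ F | v ∈ e} = {e ∈ H.edgeFinset | v ∈ e} := by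
      refine eq_of_subset_of_card_le (filter_subset_filter _ hF) ?_
      rw [card_filter_mem_eq_degree, hreg v]
      exact hcon v hv
    have h : e ∈ {e ∈ H.edgeFinset | v ∈ e} := mem_filter.2 ⟨he, hve⟩
    rw [← this] at h
    exact (mem_filter.1 h).1
  obtain ⟨e, he⟩ := nonempty_iff_ne_empty.2 hne
  have hpos : ∀ u, ∀ f ∈ F, u ∈ f → #{e ∈ F | u ∈ e} ≠ 0 := fun u f hf hu =>
    (card_pos.2 ⟨f, mem_filter.2 ⟨hf, hu⟩⟩).ne'
  have hall : ∀ u v, H.Reachable u v → #{e ∈ F | u ∈ e} ≠ 0 → #{e ∈ F | v ∈ e} ≠ 0 := by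
    rintro u v ⟨w⟩
    induction w with
    | nil => exact id
    | @cons a b c hab _ ih =>
      intro ha
      exact ih (hpos b s(a, b) (hfull a ha _ (by simpa using hab) (by simp)) (by simp))
  apply hne'
  refine hF.antisymm fun f hf => ?_
  refine hfull (f.out.1) ?_ f hf (Sym2.out_fst_mem f)
  exact hall e.out.1 f.out.1 (hconn.preconnected _ _) (hpos _ e he (Sym2.out_fst_mem e))

/-- By the handshake identity the bound of `edgeMapCount_le` factors over vertices. With z = np^Δ ≤
1, every vertex contributes at most n p^{d(v)/2} L, and a vertex with 0 < d(v) < Δ gains a further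
z^{1-d(v)/Δ} ≤ z^{1/Δ}. This gain makes partial overlaps negligible. -/
theorem edgeMapCount_le_of_regular {W : Type*} [Fintype W] [DecidableEq W] (H : SimpleGraph W)
    [DecidableRel H.Adj] (Δ : ℕ) (hΔ : 0 < Δ) (hreg : H.IsRegularOfDegree Δ)
    (hconn : H.Connected) (F : Finset (Sym2 W)) (hF : F ⊆ H.edgeFinset) (hne : F ≠ ∅)
    (hne' : F ≠ H.edgeFinset) (n : ℕ) (hn : 0 < n) (p L : ℝ) (hp : 0 < p)
    (hnp : n * p ^ Δ ≤ 1) (hL : 1 ≤ L) (G : SimpleGraph (Fin n))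
    (hG : (2 * G.edgeSet.ncard : ℝ) ≤ (n : ℝ) ^ 2 * p ^ Δ * L) :
    (edgeMapCount F G : ℝ) ≤ (n : ℝ) ^ Fintype.card W * p ^ #F *
      (((n : ℝ) * p ^ Δ) ^ (1 / (Δ : ℝ)) * L ^ Fintype.card W) := by
  have hdiag : ∀ e ∈ F, ¬ e.IsDiag := fun e he =>
    H.not_isDiag_of_mem_edgeSet (by simpa using hF he)
  have hdeg : ∀ v, #{e ∈ F | v ∈ e} ≤ Δ := fun v => by
    rw [← hreg v, ← card_filter_mem_eq_degree]
    exact card_le_card (filter_subset_filter _ hF)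
  obtain ⟨v₀, hv₀, hv₀'⟩ := exists_degree_pos_lt H Δ hreg hconn F hF hne hne'
  have hsum := sum_card_filter_mem F hdiag
  have hmain := edgeMapCount_le F hdiag Δ hΔ hdeg G
  set d : W → ℕ := fun v => #{e ∈ F | v ∈ e} with hd
  have hn' : (0 : ℝ) < n := by exact_mod_cast hn
  have hΔ' : (0 : ℝ) < Δ := by exact_mod_cast hΔ
  have hL0 : 0 < L := by linarith
  set M : ℝ := (n : ℝ) ^ 2 * p ^ Δ * L with hM
  have hM0 : 0 < M := by positivity
  set z : ℝ := (n : ℝ) * p ^ Δ with hz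
  have hz0 : 0 < z := by positivity
  have hsum' : ∑ v, (d v : ℝ) = 2 * #F := by exact_mod_cast hsum
  have hθ : ∀ v, (d v : ℝ) / Δ ≤ 1 := fun v => by
    rw [div_le_one hΔ']; exact_mod_cast hdeg v
  have hMF : M ^ ((#F : ℝ) / Δ) = ∏ v, M ^ ((d v : ℝ) / Δ / 2) := by
    rw [← Real.rpow_sum_of_pos hM0, ← sum_div, ← sum_div, hsum']
    congr 1; ring
  have hpF : (p : ℝ) ^ #F = ∏ v, p ^ ((d v : ℝ) / 2) := by
    rw [← Real.rpow_sum_of_pos hp, ← sum_div, hsum', ← Real.rpow_natCast]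
    congr 1; ring
  have hident : ∀ v, M ^ ((d v : ℝ) / Δ / 2) * M ^ (1 - (d v : ℝ) / Δ) =
      n * p ^ ((d v : ℝ) / 2) * (z ^ (1 - (d v : ℝ) / Δ) * L ^ (1 - (d v : ℝ) / Δ / 2)) := by
    intro v
    have e1 : M = z * n * L := by rw [hM, hz]; ring
    have e2 : (n : ℝ) ^ (1 - (d v : ℝ) / Δ / 2) =
        n * (n : ℝ) ^ (-((d v : ℝ) / Δ / 2)) := by
      rw [sub_eq_add_neg, Real.rpow_add hn', Real.rpow_one]
    have e3 : p ^ ((d v : ℝ) / 2) =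
        z ^ ((d v : ℝ) / Δ / 2) * (n : ℝ) ^ (-((d v : ℝ) / Δ / 2)) := by
      rw [hz, Real.mul_rpow hn'.le (by positivity), ← Real.rpow_natCast, ← Real.rpow_mul hp.le,
        mul_right_comm, ← Real.rpow_add hn', add_neg_cancel, Real.rpow_zero, one_mul]
      congr 1; field_simp
    have e4 : z ^ (1 - (d v : ℝ) / Δ / 2) = z ^ ((d v : ℝ) / Δ / 2) * z ^ (1 - (d v : ℝ) / Δ) := by
      rw [← Real.rpow_add hz0]
      congr 1; ring
    rw [← Real.rpow_add hM0, e1, Real.mul_rpow (by positivity) hL0.le,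
      Real.mul_rpow hz0.le hn'.le, e3,
      show (d v : ℝ) / Δ / 2 + (1 - (d v : ℝ) / Δ) = 1 - (d v : ℝ) / Δ / 2 by ring, e2, e4]
    ring
  have hd0 : ∀ v, 0 ≤ (d v : ℝ) / Δ := fun v => by positivity
  have hfac : ∀ v, M ^ ((d v : ℝ) / Δ / 2) * (if d v = 0 then (n : ℝ) else
      M ^ (1 - (d v : ℝ) / Δ)) ≤
      n * p ^ ((d v : ℝ) / 2) * ((if v = v₀ then z ^ (1 / (Δ : ℝ)) else 1) * L) := by
    intro v
    have hLle : L ^ (1 - (d v : ℝ) / Δ / 2) ≤ L := by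
      conv_rhs => rw [← Real.rpow_one L]
      exact Real.rpow_le_rpow_of_exponent_le hL (by linarith [hd0 v])
    by_cases hv : v = v₀
    · subst hv
      rw [if_neg hv₀, if_pos rfl, hident]
      have : z ^ (1 - (d v : ℝ) / Δ) ≤ z ^ (1 / (Δ : ℝ)) := by
        refine Real.rpow_le_rpow_of_exponent_ge hz0 hnp ?_
        rw [div_le_iff₀ hΔ', sub_mul, div_mul_cancel₀ _ hΔ'.ne', one_mul]
        have : ((d v + 1 : ℕ) : ℝ) ≤ Δ := by exact_mod_cast hv₀'
        push_cast at this
        linarith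
      gcongr
    · rw [if_neg hv, one_mul]
      by_cases h0 : d v = 0
      · simp only [h0, if_true, Nat.cast_zero, zero_div, Real.rpow_zero, one_mul, mul_one]
        exact le_mul_of_one_le_right hn'.le hL
      · rw [if_neg h0, hident]
        have : z ^ (1 - (d v : ℝ) / Δ) ≤ 1 :=
          Real.rpow_le_one hz0.le hnp (by linarith [hθ v])
        refine mul_le_mul_of_nonneg_left ?_ (by positivity)
        calc _ ≤ 1 * L := by gcongr
          _ = L := one_mul _
  calc (edgeMapCount F G : ℝ) ≤ _ := hmain
    _ ≤ M ^ ((#F : ℝ) / Δ) * ∏ v, (if d v = 0 then (n : ℝ) else M ^ (1 - (d v : ℝ) / Δ)) := by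
        refine mul_le_mul (Real.rpow_le_rpow (by positivity) hG (by positivity))
          (prod_le_prod (fun v _ => by split_ifs <;> positivity) fun v _ => ?_)
          (prod_nonneg fun v _ => by split_ifs <;> positivity) (by positivity)
        rw [Fintype.card_fin]
        split_ifs
        · rfl
        · exact Real.rpow_le_rpow (by positivity) hG (by linarith [hθ v])
    _ = ∏ v, M ^ ((d v : ℝ) / Δ / 2) * (if d v = 0 then (n : ℝ) else
          M ^ (1 - (d v : ℝ) / Δ)) := by rw [hMF, prod_mul_distrib]
    _ ≤ ∏ v, n * p ^ ((d v : ℝ) / 2) * ((if v = v₀ then z ^ (1 / (Δ : ℝ)) else 1) * L) :=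
        prod_le_prod (fun v _ => by split_ifs <;> positivity) fun v _ => hfac v
    _ = _ := by
        rw [prod_mul_distrib, prod_mul_distrib, prod_mul_distrib, ← hpF, prod_const, prod_const,
          prod_ite_eq' univ v₀ (fun _ => z ^ (1 / (Δ : ℝ))), card_univ, if_pos (mem_univ _)]

theorem sum_pow_missing_le_of_regular {W : Type*} [Fintype W] (H : SimpleGraph W)
    [DecidableRel H.Adj] (Δ : ℕ) (hΔ : 0 < Δ) (hreg : H.IsRegularOfDegree Δ)
    (hconn : H.Connected) (n : ℕ) (hn : 0 < n) (p L : ℝ) (hp : 0 < p) (hp1 : p ≤ 1)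
    (hnp : n * p ^ Δ ≤ 1) (hL : 1 ≤ L) (G : SimpleGraph (Fin n))
    (hG : (2 * G.edgeSet.ncard : ℝ) ≤ (n : ℝ) ^ 2 * p ^ Δ * L) :
    ∑ φ : W ↪ Fin n, p ^ missing H φ G ≤
      (n : ℝ) ^ Fintype.card W * p ^ H.edgeSet.ncard *
        (1 + 2 ^ H.edgeSet.ncard * (((n : ℝ) * p ^ Δ) ^ (1 / (Δ : ℝ)) * L ^ Fintype.card W)) +
          G.labelledCopyCount H := by
  classical
  have hE : #H.edgeFinset = H.edgeSet.ncard := by rw [Set.ncard_eq_toFinset_card']; rfl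
  have h := sum_pow_missing_le H p hp.le hp1 H.edgeFinset (by simp) G
  rw [hE, Fintype.card_fin] at h
  set Y := ((n : ℝ) * p ^ Δ) ^ (1 / (Δ : ℝ)) * L ^ Fintype.card W with hY
  have hY0 : 0 ≤ Y := by have : 0 ≤ L := by linarith
                         positivity
  have hs : ∑ F ∈ H.edgeFinset.powerset with F ≠ ∅ ∧ F ≠ H.edgeFinset,
      edgeMapCount F G * p ^ (H.edgeSet.ncard - #F) ≤
      2 ^ H.edgeSet.ncard * ((n : ℝ) ^ Fintype.card W * p ^ H.edgeSet.ncard * Y) := by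
    refine (sum_le_card_nsmul _ _ ((n : ℝ) ^ Fintype.card W * p ^ H.edgeSet.ncard * Y) ?_).trans ?_
    · intro F hF
      rw [mem_filter, mem_powerset] at hF
      have hle : #F ≤ H.edgeSet.ncard := hE ▸ card_le_card hF.1
      have := edgeMapCount_le_of_regular H Δ hΔ hreg hconn F hF.1 hF.2.1 hF.2.2 n hn p L hp hnp hL
        G hG
      calc _ ≤ (n : ℝ) ^ Fintype.card W * p ^ #F * Y * p ^ (H.edgeSet.ncard - #F) := by gcongr
        _ = (n : ℝ) ^ Fintype.card W * (p ^ #F * p ^ (H.edgeSet.ncard - #F)) * Y := by ring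
        _ = _ := by rw [← pow_add, Nat.add_sub_cancel' hle]
    · rw [nsmul_eq_mul]
      refine mul_le_mul_of_nonneg_right ?_ (by positivity)
      have := card_filter_le H.edgeFinset.powerset (fun F => F ≠ ∅ ∧ F ≠ H.edgeFinset)
      rw [card_powerset, hE] at this
      exact_mod_cast this
  linarith

end UpperTail

/-! ### Upper and lower probability bounds -/

namespace UpperTail
open Finset

theorem two_mul_ncard_edgeSet {W : Type*} [Fintype W] (H : SimpleGraph W) [DecidableRel H.Adj]
    (Δ : ℕ) (hreg : H.IsRegularOfDegree Δ) : 2 * H.edgeSet.ncard = Fintype.card W * Δ := by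
  classical
  have h := H.sum_degrees_eq_twice_card_edges
  have hE : #H.edgeFinset = H.edgeSet.ncard := by rw [Set.ncard_eq_toFinset_card']; rfl
  simp only [hreg.degree_eq, sum_const, card_univ, smul_eq_mul] at h
  rw [h, hE]

theorem real_upperTail_le {W : Type*} [Fintype W] (H : SimpleGraph W)
    [DecidableRel H.Adj] (Δ : ℕ) (hΔ : 0 < Δ) (hreg : H.IsRegularOfDegree Δ)
    (hconn : H.Connected) (δ ε C : ℝ) (hδ : 0 < δ) (hε : 0 < ε) (hε1 : ε < 1)
    (n : ℕ) (hn : 0 < n) (p : unitInterval) (hp : 0 < (p : ℝ))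
    (hnp : n * (p : ℝ) ^ Δ ≤ 1)
    (hL : 1 ≤ 2 * C * Real.log (1 / p))
    (hY : 2 ^ H.edgeSet.ncard * (((n : ℝ) * (p : ℝ) ^ Δ) ^ (1 / (Δ : ℝ)) *
      (2 * C * Real.log (1 / p)) ^ Fintype.card W) ≤ δ * ε)
    (k : ℕ) (hk : (k * H.edgeSet.ncard : ℝ) ≤ C * (n : ℝ) ^ 2 * (p : ℝ) ^ Δ * Real.log (1 / p)) :
    (SimpleGraph.binomialRandom (Fin n) p).real (upperTail H δ n p) ≤
      ((1 + δ - δ * ε) / (1 + δ)) ^ k +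
        (SimpleGraph.binomialRandom (Fin n) p).real (containsCore H Δ δ ε C n p) := by
  have hn' : (0 : ℝ) < n := by exact_mod_cast hn
  set m := C * (n : ℝ) ^ 2 * (p : ℝ) ^ Δ * Real.log (1 / p) with hm
  have hm0 : 0 < m := by
    have : m = (n : ℝ) ^ 2 * (p : ℝ) ^ Δ * (2 * C * Real.log (1 / p)) / 2 := by rw [hm]; ring
    rw [this]
    positivity
  set μ := (n : ℝ) ^ Fintype.card W * (p : ℝ) ^ H.edgeSet.ncard with hμ
  have hμ0 : 0 < μ := by positivity
  have h1 : 0 ≤ 1 + δ - δ * ε := by nlinarith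
  have hmain := real_upperTail_inter_le H p (containsCore H Δ δ ε C n p)ᶜ m
    (μ * (1 + δ - δ * ε)) ((1 + δ) * (n : ℝ) ^ Fintype.card W * (p : ℝ) ^ H.edgeSet.ncard)
    (by positivity) (by positivity)
    (fun U => (U.labelledCopyCount H : ℝ) ≤ δ * (1 - 2 * ε) * μ)
    (by
      intro Γ hΓ U hU hUm
      by_contra hcon
      obtain ⟨G', hle, hcore⟩ := exists_isCore_le H Δ δ ε C hδ.le hε.le n p hp.le U hm0 hUm
        (by rw [hμ] at hcon; linarith)
      exact hΓ ⟨G', hle.trans hU, hcore⟩)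
    (by
      intro U hU hUm
      have := sum_pow_missing_le_of_regular H Δ hΔ hreg hconn n hn p (2 * C * Real.log (1 / p)) hp
        p.2.2 hnp hL U (by rw [hm] at hUm; linarith)
      refine this.trans ?_
      -- Of the 2δε saved on full copies in `U`, one δε pays for the partial overlaps; the other
      -- makes the final ratio smaller than one.
      calc _ ≤ μ * (1 + δ * ε) + δ * (1 - 2 * ε) * μ := by gcongr
        _ = _ := by ring)
    k hk
  have hratio : μ * (1 + δ - δ * ε) /
      ((1 + δ) * (n : ℝ) ^ Fintype.card W * (p : ℝ) ^ H.edgeSet.ncard) =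
      (1 + δ - δ * ε) / (1 + δ) := by
    rw [mul_assoc (1 + δ), ← hμ, mul_comm (1 + δ) μ, mul_div_mul_left _ _ hμ0.ne']
  rw [hratio] at hmain
  refine le_trans ?_ (add_le_add_left hmain _)
  refine le_trans (MeasureTheory.measureReal_mono ?_) (MeasureTheory.measureReal_union_le _ _)
  intro G hG
  by_cases hc : G ∈ containsCore H Δ δ ε C n p
  · exact Or.inr hc
  · exact Or.inl ⟨hG, hc⟩

theorem pow_le_real_containsCore {W : Type*} [Fintype W] (H : SimpleGraph W) (Δ : ℕ)
    (δ ε C : ℝ) (hδ : 0 ≤ δ) (hε : 0 ≤ ε) (n : ℕ) (p : unitInterval)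
    (hm : 0 < C * (n : ℝ) ^ 2 * (p : ℝ) ^ Δ * Real.log (1 / p)) (k : ℕ) (hkn : k ≤ n)
    (hkm : (k : ℝ) ^ 2 ≤ C * (n : ℝ) ^ 2 * (p : ℝ) ^ Δ * Real.log (1 / p))
    (hN : δ * (1 - 2 * ε) * (n : ℝ) ^ Fintype.card W * (p : ℝ) ^ H.edgeSet.ncard ≤
      ((k + 1 - Fintype.card W : ℕ) : ℝ) ^ Fintype.card W) :
    (p : ℝ) ^ (k ^ 2) ≤
      (SimpleGraph.binomialRandom (Fin n) p).real (containsCore H Δ δ ε C n p) := by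
  obtain ⟨G, h1, h2⟩ := exists_clique H hkn
  have hp0 : (0 : ℝ) ≤ p := p.2.1
  obtain ⟨G', hle, hcore⟩ := exists_isCore_le H Δ δ ε C hδ hε n p hp0 G hm
    (le_trans (by exact_mod_cast h1) hkm) (le_trans hN (by exact_mod_cast h2))
  calc (p : ℝ) ^ (k ^ 2) ≤ (p : ℝ) ^ G.edgeSet.ncard := pow_le_pow_of_le_one hp0 p.2.2 h1
    _ = _ := (binomialRandom_real_ge p G).symm
    _ ≤ _ := by
      refine MeasureTheory.measureReal_mono fun Γ hΓ => ?_
      exact ⟨G', hle.trans hΓ, hcore⟩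

/-- Here 1-3ε ≤ 0, so the empty graph is already a core. -/
theorem mem_containsCore_of_one_third_le {W : Type*} [Fintype W] (H : SimpleGraph W) (Δ : ℕ)
    (δ ε C : ℝ) (hδ : 0 ≤ δ) (hε : 1 / 3 ≤ ε) (hC : 0 ≤ C) (n : ℕ) (p : ℝ) (hp : 0 < p)
    (hp1 : p ≤ 1) (Γ : SimpleGraph (Fin n)) : Γ ∈ containsCore H Δ δ ε C n p := by
  refine ⟨⊥, bot_le, ⟨?_, ?_, by simp⟩⟩
  · refine le_trans ?_ (Nat.cast_nonneg _)
    rw [mul_assoc, mul_assoc]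
    exact mul_nonpos_of_nonneg_of_nonpos hδ
      (mul_nonpos_of_nonpos_of_nonneg (by linarith) (by positivity))
  · have : 0 ≤ Real.log (1 / p) := Real.log_nonneg (by rw [le_div_iff₀ hp]; linarith)
    simp only [SimpleGraph.edgeSet_bot, Set.ncard_empty, Nat.cast_zero]
    positivity

/-! ### Consequences of the two growth conditions on p -/

section Asymptotics

variable {p : ℕ → ℝ} {Δ : ℕ}

theorem tendsto_mul_pow_zero {a : ℝ} (ha : 0 < a)
    (hsmall : (fun n : ℕ => (n : ℝ) * p n ^ Δ) =o[atTop]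
      (fun n : ℕ => Real.log (n : ℝ) ^ (-a))) :
    Tendsto (fun n : ℕ => (n : ℝ) * p n ^ Δ) atTop (𝓝 0) :=
  hsmall.trans_tendsto ((tendsto_rpow_neg_atTop ha).comp
    (Real.tendsto_log_atTop.comp tendsto_natCast_atTop_atTop))

theorem tendsto_zero_of_mul_pow (hΔ : 0 < Δ) (hp : ∀ n, 0 < p n)
    (h : Tendsto (fun n : ℕ => (n : ℝ) * p n ^ Δ) atTop (𝓝 0)) : Tendsto p atTop (𝓝 0) := by
  have h1 : Tendsto (fun n => p n ^ Δ) atTop (𝓝 0) := by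
    refine squeeze_zero' (Eventually.of_forall fun n => (pow_pos (hp n) _).le) ?_ h
    filter_upwards [eventually_ge_atTop 1] with n hn
    exact le_mul_of_one_le_left (pow_pos (hp n) _).le (by exact_mod_cast hn)
  have h2 := h1.rpow_const (p := 1 / (Δ : ℝ)) (Or.inr (by positivity))
  rw [Real.zero_rpow (by positivity)] at h2
  refine h2.congr fun n => ?_
  rw [one_div, Real.pow_rpow_inv_natCast (hp n).le hΔ.ne']

theorem tendsto_log_one_div (hp : ∀ n, 0 < p n) (h : Tendsto p atTop (𝓝 0)) :
    Tendsto (fun n => Real.log (1 / p n)) atTop atTop := by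
  refine Real.tendsto_log_atTop.comp ?_
  simp only [one_div]
  have h' : Tendsto p atTop (𝓝[>] 0) := by
    rw [tendsto_nhdsWithin_iff]
    exact ⟨h, Eventually.of_forall hp⟩
  exact h'.inv_tendsto_nhdsGT_zero

theorem eventually_log_one_div_le (hΔ : 2 ≤ Δ) (hp : ∀ n, 0 < p n ∧ p n < 1)
    (hbig : Tendsto (fun n : ℕ => (n : ℝ) * p n ^ ((Δ : ℝ) / 2)) atTop atTop) :
    ∀ᶠ n : ℕ in atTop, Real.log (1 / p n) ≤ Real.log n := by
  filter_upwards [hbig.eventually_ge_atTop 1] with n hn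
  have h0 := (hp n).1
  refine Real.log_le_log (by positivity) ?_
  rw [div_le_iff₀ h0]
  refine hn.trans (mul_le_mul_of_nonneg_left ?_ (Nat.cast_nonneg _))
  conv_rhs => rw [← Real.rpow_one (p n)]
  refine Real.rpow_le_rpow_of_exponent_ge h0 (hp n).2.le ?_
  have : (2 : ℝ) ≤ Δ := by exact_mod_cast hΔ
  linarith

/-- The exponent -Δv in the hypothesis becomes -v after the Δ-th root, exactly cancelling the power
of log(1/p) ≤ log n. -/
theorem tendsto_error (hΔ : 2 ≤ Δ) (hp : ∀ n, 0 < p n ∧ p n < 1)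
    (hbig : Tendsto (fun n : ℕ => (n : ℝ) * p n ^ ((Δ : ℝ) / 2)) atTop atTop) (v : ℕ)
    (hsmall : (fun n : ℕ => (n : ℝ) * p n ^ Δ) =o[atTop]
      (fun n : ℕ => Real.log (n : ℝ) ^ (-((Δ : ℝ) * v)))) (C : ℝ) (hC : 0 ≤ C) :
    Tendsto (fun n : ℕ => ((n : ℝ) * p n ^ Δ) ^ (1 / (Δ : ℝ)) *
      (C * Real.log (1 / p n)) ^ v) atTop (𝓝 0) := by
  have hΔ0 : (0 : ℝ) < Δ := by exact_mod_cast (by omega : 0 < Δ)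
  have h1 := (hsmall.tendsto_div_nhds_zero.rpow_const (p := 1 / (Δ : ℝ))
    (Or.inr (by positivity))).const_mul (C ^ v)
  rw [Real.zero_rpow (by positivity), mul_zero] at h1
  have hlog0 : ∀ n, 0 ≤ Real.log (1 / p n) := fun n =>
    Real.log_nonneg (by rw [le_div_iff₀ (hp n).1]; linarith [(hp n).2])
  refine squeeze_zero' (Eventually.of_forall fun n => ?_) ?_ h1
  · have := (hp n).1
    have := hlog0 n
    positivity
  · filter_upwards [eventually_log_one_div_le hΔ hp hbig, eventually_ge_atTop 2] with n hn hn2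
    have hp0 := (hp n).1
    have hl0 := hlog0 n
    have hlog : 0 < Real.log n := Real.log_pos (by exact_mod_cast hn2)
    rw [Real.rpow_neg hlog.le, div_inv_eq_mul,
      Real.mul_rpow (x := (n : ℝ) * p n ^ Δ) (by positivity) (by positivity),
      ← Real.rpow_mul hlog.le, show (Δ : ℝ) * v * (1 / Δ) = v by field_simp, Real.rpow_natCast]
    calc _ ≤ ((n : ℝ) * p n ^ Δ) ^ (1 / (Δ : ℝ)) * (C * Real.log n) ^ v := by gcongr
      _ = _ := by rw [mul_pow]; ring

end Asymptotics

/-! ### Comparing the two bounds and choosing the constant -/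

/-- Rounding down costs a factor 1/q; the spare e^{-B} from K+1 pays for it and for the factor ε. -/
theorem pow_le_mul_exp_neg {q ε c B m e K : ℝ} (hq : 0 < q) (hq1 : q < 1)
    (hc : c = -Real.log q) (hm : (K + 1) * B ≤ c * m / e)
    (hB : Real.exp (-B) ≤ ε * q) :
    q ^ ⌊m / e⌋₊ ≤ ε * Real.exp (-(K * B)) := by
  have hfl : m / e - 1 ≤ (⌊m / e⌋₊ : ℝ) := by linarith [Nat.lt_floor_add_one (m / e)]
  have hlogq : Real.log q ≤ 0 := Real.log_nonpos hq.le hq1.le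
  calc q ^ ⌊m / e⌋₊ = q ^ ((⌊m / e⌋₊ : ℕ) : ℝ) := (Real.rpow_natCast _ _).symm
    _ ≤ q ^ (m / e - 1) := Real.rpow_le_rpow_of_exponent_ge hq hq1.le hfl
    _ = Real.exp (-(c * m / e)) * q⁻¹ := by
        rw [Real.rpow_sub hq, Real.rpow_one, Real.rpow_def_of_pos hq, div_eq_mul_inv, hc]
        congr 2; ring
    _ ≤ Real.exp (-(K * B)) * Real.exp (-B) * q⁻¹ := by
        rw [← Real.exp_add]
        gcongr
        linarith
    _ ≤ Real.exp (-(K * B)) * (ε * q) * q⁻¹ := by gcongr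
    _ = _ := by field_simp

theorem exp_neg_le_real_containsCore {W : Type*} [Fintype W] (H : SimpleGraph W) (Δ : ℕ)
    (hedge : 2 * H.edgeSet.ncard = Fintype.card W * Δ) (hcard : 0 < Fintype.card W)
    (δ ε C K : ℝ) (hδ : 0 < δ) (hε : 0 < ε) (hK : K = 3 + δ) (hCK : K ^ 2 ≤ C) (n : ℕ)
    (p : unitInterval) (hp : 0 < (p : ℝ)) (hlog : 1 ≤ Real.log (1 / p))
    (hpK : (p : ℝ) ^ ((Δ : ℝ) / 2) ≤ K⁻¹) (hx1 : 1 ≤ (n : ℝ) * (p : ℝ) ^ ((Δ : ℝ) / 2))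
    (hxv : (Fintype.card W : ℝ) ≤ (n : ℝ) * (p : ℝ) ^ ((Δ : ℝ) / 2)) :
    Real.exp (-(K ^ 2 * ((n : ℝ) ^ 2 * (p : ℝ) ^ Δ * Real.log (1 / p)))) ≤
      (SimpleGraph.binomialRandom (Fin n) p).real (containsCore H Δ δ ε C n p) := by
  have hK0 : 0 < K := by rw [hK]; positivity
  have hC0 : 0 < C := lt_of_lt_of_le (by positivity) hCK
  have hsq : ((n : ℝ) * (p : ℝ) ^ ((Δ : ℝ) / 2)) ^ 2 = (n : ℝ) ^ 2 * (p : ℝ) ^ Δ := by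
    rw [mul_pow, ← Real.rpow_natCast ((p : ℝ) ^ ((Δ : ℝ) / 2)), ← Real.rpow_mul hp.le]
    norm_num
  set x : ℝ := (n : ℝ) * (p : ℝ) ^ ((Δ : ℝ) / 2) with hx
  set B : ℝ := (n : ℝ) ^ 2 * (p : ℝ) ^ Δ * Real.log (1 / p) with hB
  have hmB : C * (n : ℝ) ^ 2 * (p : ℝ) ^ Δ * Real.log (1 / p) = C * B := by rw [hB]; ring
  have hB0 : 0 < B := by rw [hB, ← hsq]; positivity
  have hm0 : 0 < C * (n : ℝ) ^ 2 * (p : ℝ) ^ Δ * Real.log (1 / p) := by rw [hmB]; positivity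
  -- Since v(H) ≤ x, at least (1+δ)x remains after the subtraction in the clique count. Since x ≥ 1,
  -- rounding up keeps `k` below Kx = (3+δ)x.
  set k : ℕ := ⌈(2 + δ) * x⌉₊ with hk
  have hk1 : (2 + δ) * x ≤ k := Nat.le_ceil _
  have hk2 : (k : ℝ) ≤ K * x := by
    have := Nat.ceil_lt_add_one (show 0 ≤ (2 + δ) * x by positivity)
    rw [hK]; linarith
  have hkn : k ≤ n := by
    have : (k : ℝ) ≤ n := by
      refine hk2.trans ?_
      calc K * x = n * (K * (p : ℝ) ^ ((Δ : ℝ) / 2)) := by rw [hx]; ring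
        _ ≤ n * (K * K⁻¹) := by gcongr
        _ = n := by rw [mul_inv_cancel₀ (by positivity), mul_one]
    exact_mod_cast this
  have hksq : (k : ℝ) ^ 2 ≤ K ^ 2 * ((n : ℝ) ^ 2 * (p : ℝ) ^ Δ) := by
    rw [← hsq, ← mul_pow]
    gcongr
  have hlow := pow_le_real_containsCore H Δ δ ε C hδ.le hε.le n p hm0 k hkn
    (by
      refine hksq.trans ?_
      rw [hmB, hB]
      have : (n : ℝ) ^ 2 * (p : ℝ) ^ Δ ≤ (n : ℝ) ^ 2 * (p : ℝ) ^ Δ * Real.log (1 / p) :=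
        le_mul_of_one_le_right (by positivity) hlog
      gcongr)
    (by
      have hsub : (1 + δ) * x ≤ ((k + 1 - Fintype.card W : ℕ) : ℝ) := by
        have h1 : ((k + 1 : ℕ) : ℝ) ≤ ((k + 1 - Fintype.card W : ℕ) : ℝ) + Fintype.card W := by
          exact_mod_cast (by omega : k + 1 ≤ (k + 1 - Fintype.card W) + Fintype.card W)
        push_cast at h1
        linarith
      have hxpow : x ^ Fintype.card W =
          (n : ℝ) ^ Fintype.card W * (p : ℝ) ^ H.edgeSet.ncard := by
        rw [hx, mul_pow, ← Real.rpow_natCast ((p : ℝ) ^ ((Δ : ℝ) / 2)),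
          ← Real.rpow_mul hp.le, ← Real.rpow_natCast (p : ℝ) H.edgeSet.ncard]
        congr 2
        have : (2 : ℝ) * H.edgeSet.ncard = Fintype.card W * Δ := by exact_mod_cast hedge
        linarith
      calc _ = δ * (1 - 2 * ε) * x ^ Fintype.card W := by rw [hxpow]; ring
        _ ≤ (1 + δ) ^ Fintype.card W * x ^ Fintype.card W := by
            refine mul_le_mul_of_nonneg_right ?_ (by positivity)
            have := le_self_pow₀ (show 1 ≤ 1 + δ by linarith) hcard.ne'
            nlinarith
        _ = ((1 + δ) * x) ^ Fintype.card W := (mul_pow _ _ _).symm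
        _ ≤ _ := by gcongr)
  have hexplow : Real.exp (-(K ^ 2 * B)) ≤ (p : ℝ) ^ (k ^ 2) := by
    rw [← Real.exp_log (show 0 < (p : ℝ) ^ (k ^ 2) by positivity), Real.log_pow]
    refine Real.exp_le_exp.2 ?_
    have hl : Real.log p = -Real.log (1 / p) := by rw [one_div, Real.log_inv, neg_neg]
    have := mul_le_mul_of_nonneg_right hksq (show 0 ≤ Real.log (1 / (p : ℝ)) by linarith)
    rw [hl, hB, Nat.cast_pow]
    linarith only [this]
  exact hexplow.trans hlow

end UpperTail

open UpperTail in
theorem lemmal {W : Type*} [Fintype W] (H : SimpleGraph W) [DecidableRel H.Adj] (Δ : ℕ)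
    (hΔ : 2 ≤ Δ) (hreg : H.IsRegularOfDegree Δ) (hconn : H.Connected)
    (δ : ℝ) (hδ : 0 < δ) (ε : ℝ) (hε : 0 < ε) :
    ∃ C₀ : ℝ, 0 < C₀ ∧ ∀ C : ℝ, C₀ ≤ C →
      ∀ p : ℕ → unitInterval, (∀ n, 0 < (p n : ℝ) ∧ (p n : ℝ) < 1) →
        Tendsto (fun n : ℕ => (n : ℝ) * (p n : ℝ) ^ ((Δ : ℝ) / 2)) atTop atTop →
        (fun n : ℕ => (n : ℝ) * (p n : ℝ) ^ Δ) =o[atTop]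
          (fun n : ℕ => Real.log (n : ℝ) ^ (-((Δ : ℝ) * (Fintype.card W : ℝ)))) →
        ∀ᶠ n : ℕ in atTop,
          (SimpleGraph.binomialRandom (Fin n) (p n)).real (UpperTail.upperTail H δ n (p n)) ≤
            (1 + ε) * (SimpleGraph.binomialRandom (Fin n) (p n)).real
              (UpperTail.containsCore H Δ δ ε C n (p n)) := by
  have hΔ0 : 0 < Δ := by omega
  have hΔ' : (0 : ℝ) < Δ := by exact_mod_cast hΔ0
  rcases le_or_gt (1 / 3) ε with hε3 | hε3
  · refine ⟨1, one_pos, fun C hC p hp _ _ => Eventually.of_forall fun n => ?_⟩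
    have huniv : UpperTail.containsCore H Δ δ ε C n (p n) = Set.univ :=
      Set.eq_univ_of_forall fun Γ => mem_containsCore_of_one_third_le H Δ δ ε C hδ.le hε3
        (by linarith) n (p n) (hp n).1 (hp n).2.le Γ
    rw [huniv, MeasureTheory.probReal_univ]
    exact MeasureTheory.measureReal_le_one.trans (by linarith)
  have hcard : 0 < Fintype.card W := Fintype.card_pos_iff.2 hconn.nonempty
  have hedge := two_mul_ncard_edgeSet H Δ hreg
  have heH : 0 < H.edgeSet.ncard := by
    have := Nat.mul_pos hcard hΔ0
    omega
  have heH' : (0 : ℝ) < H.edgeSet.ncard := by exact_mod_cast heH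
  set q : ℝ := (1 + δ - δ * ε) / (1 + δ) with hq
  have hq0 : 0 < q := div_pos (by nlinarith) (by linarith)
  have hq1 : q < 1 := by
    rw [hq, div_lt_one (by linarith)]
    nlinarith [mul_pos hδ hε]
  set c : ℝ := -Real.log q with hc
  have hc0 : 0 < c := neg_pos.2 (Real.log_neg hq0 hq1)
  set K : ℝ := 3 + δ with hK
  -- The first term lets the clique fit the edge budget; the second makes the decay q^{CB/e(H)} beat
  -- exp(-K²B) with a factor e^{-B} to spare.
  refine ⟨max (K ^ 2) ((K ^ 2 + 1) * H.edgeSet.ncard / c), lt_max_of_lt_left (by positivity),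
    fun C hC p hp hbig hsmall => ?_⟩
  have hCK : K ^ 2 ≤ C := (le_max_left _ _).trans hC
  have hCc : (K ^ 2 + 1) * H.edgeSet.ncard / c ≤ C := (le_max_right _ _).trans hC
  have hC0 : 0 < C := lt_of_lt_of_le (by positivity) hCK
  have hC1 : 1 ≤ C := le_trans (by nlinarith) hCK
  have hp0 : ∀ n, 0 < (p n : ℝ) := fun n => (hp n).1
  have hz := tendsto_mul_pow_zero (by positivity) hsmall
  have hpt := tendsto_zero_of_mul_pow hΔ0 hp0 hz
  have hlog := tendsto_log_one_div hp0 hpt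
  have hY := (tendsto_error hΔ hp hbig _ hsmall (2 * C) (by positivity)).const_mul
    (2 ^ H.edgeSet.ncard)
  rw [mul_zero] at hY
  have hsq : ∀ n : ℕ, ((n : ℝ) * (p n : ℝ) ^ ((Δ : ℝ) / 2)) ^ 2 = (n : ℝ) ^ 2 * (p n : ℝ) ^ Δ := by
    intro n
    rw [mul_pow, ← Real.rpow_natCast ((p n : ℝ) ^ ((Δ : ℝ) / 2)), ← Real.rpow_mul (hp0 n).le]
    norm_num
  have hBt : Tendsto (fun n : ℕ => (n : ℝ) ^ 2 * (p n : ℝ) ^ Δ * Real.log (1 / p n))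
      atTop atTop := by
    refine Tendsto.atTop_mul_atTop₀ ?_ hlog
    exact ((tendsto_pow_atTop two_ne_zero).comp hbig).congr hsq
  have hexp := Real.tendsto_exp_neg_atTop_nhds_zero.comp hBt
  have hpΔ := hpt.rpow_const (p := (Δ : ℝ) / 2) (Or.inr (by positivity))
  rw [Real.zero_rpow (by positivity)] at hpΔ
  filter_upwards [eventually_gt_atTop 0, hz.eventually_le_const one_pos,
    hlog.eventually_ge_atTop 1, hY.eventually_le_const (mul_pos hδ hε),
    hexp.eventually_le_const (mul_pos hε hq0),
    hpΔ.eventually_le_const (show (0 : ℝ) < K⁻¹ by positivity),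
    hbig.eventually_ge_atTop 1, hbig.eventually_ge_atTop (Fintype.card W)]
    with n hn hzn hlogn hYn hexpn hpn hx1 hxv
  have hn' : (0 : ℝ) < n := by exact_mod_cast hn
  have hpn0 := hp0 n
  set B : ℝ := (n : ℝ) ^ 2 * (p n : ℝ) ^ Δ * Real.log (1 / p n) with hB
  have hmB : C * (n : ℝ) ^ 2 * (p n : ℝ) ^ Δ * Real.log (1 / p n) = C * B := by rw [hB]; ring
  have hB0 : 0 < B := by positivity
  have hm0 : 0 < C * (n : ℝ) ^ 2 * (p n : ℝ) ^ Δ * Real.log (1 / p n) := by rw [hmB]; positivity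
  -- The largest moment that the edge budget allows.
  have hup := real_upperTail_le H Δ hΔ0 hreg hconn δ ε C hδ hε (by linarith) n hn (p n) hpn0 hzn
    (by nlinarith) hYn ⌊C * B / H.edgeSet.ncard⌋₊ (by
      rw [hmB, ← le_div_iff₀ heH']
      exact Nat.floor_le (by positivity))
  have hlow := exp_neg_le_real_containsCore H Δ hedge hcard δ ε C K hδ hε hK hCK n (p n) hpn0 hlogn
    hpn hx1 hxv
  have hqpow := pow_le_mul_exp_neg (K := K ^ 2) (B := B) (m := C * B) hq0 hq1 hc
    (by
      rw [div_le_iff₀ hc0] at hCc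
      rw [le_div_iff₀ heH']
      nlinarith) hexpn
  calc _ ≤ _ := hup
    _ ≤ ε * (SimpleGraph.binomialRandom (Fin n) (p n)).real (containsCore H Δ δ ε C n (p n)) +
        (SimpleGraph.binomialRandom (Fin n) (p n)).real (containsCore H Δ δ ε C n (p n)) := by
        refine add_le_add_left (hqpow.trans ?_) _
        exact mul_le_mul_of_nonneg_left hlow hε.le
    _ = _ := by ring
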